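/- Let $(\Omega,\mathcal F,\mathbb P)$ be a complete probability space carrying a standard one-dimensional Brownian motion $W$, let $\mathbb F$ be the usual augmentation of the natural filtration of $W$, let $T>0$, and let $\mathcal U_i[0,T]$ ($i=1,2$) be the set of $\mathbb F$-progressively measurable $u_i:[0,T]\times\Omega\to\mathbb R^{m_i}$ with $\mathbb E\int_0^T|u_i(t)|^2dt<\infty$. For $x\in\mathbb R^n$ and $u_i\in\mathcal U_i[0,T]$ let $X$ be the unique (up to indistinguishability) square-integrable continuous $\mathbb F$-progressively measurable strong solution of $$dX=(AX+B_1u_1+B_2u_2)\,dt+(CX+D_1u_1+D_2u_2)\,dW,\qquad X(0)=x,$$ on $[0,T]$, and put $$J(x;u_1,u_2)=\mathbb E\Big\{\langle GX(T),X(T)\rangle+\int_0^T\Big\langle\begin{pmatrix}Q&S_1^\top&S_2^\top\\S_1&R_{11}&R_{12}\\S_2&R_{21}&R_{22}\end{pmatrix}\begin{pmatrix}X\\u_1\\u_2\end{pmatrix},\begin{pmatrix}X\\u_1\\u_2\end{pmatrix}\Big\rangle dt\Big\}.$$ Here $A,C,Q:[0,T]\to\mathbb R^{n\times n}$, $B_i,D_i:[0,T]\to\mathbb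 R^{n\times m_i}$, $S_i:[0,T]\to\mathbb R^{m_i\times n}$ and $R_{ij}:[0,T]\to\mathbb R^{m_i\times m_j}$ are deterministic, Lebesgue measurable and essentially bounded, $G\in\mathbb R^{n\times n}$, and $G^\top=G$, $Q^\top=Q$, $R_{ij}^\top=R_{ji}$. Define the open-loop lower and upper values, in $[-\infty,+\infty]$, by $$V^-(x)=\sup_{u_2\in\mathcal U_2[0,T]}\ \inf_{u_1\in\mathcal U_1[0,T]}J(x;u_1,u_2),\qquad V^+(x)=\inf_{u_1\in\mathcal U_1[0,T]}\ \sup_{u_2\in\mathcal U_2[0,T]}J(x;u_1,u_2).$$ (i) If $V^-(x)$ is finite for some $x\in\mathbb R^n$, then $J(0;u_1,0)\ge0$ for all $u_1\in\mathcal U_1[0,T]$. (ii) If $V^+(x)$ is finite for some $x\in\mathbb R^n$, then $J(0;0,u_2)\le0$ for all $u_2\in\mathcal U_2[0,T]$. -/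

import Mathlib

open MeasureTheory ProbabilityTheory Filter Topology
open scoped NNReal ENNReal

noncomputable section

namespace LQGame

/-! ### The probabilistic setting -/

section Probability

variable {Ω : Type*} {mΩ : MeasurableSpace Ω}

/-- The usual augmentation `𝔽 = (𝓕_t)` of the natural filtration of the Brownian motion `W`
on a complete probability space: the sets of probability zero are added to `σ(W_s, s ≤ t)`, and
the right-continuous version of the resulting filtration is taken. -/
def brownianFiltration {P : Measure Ω} [P.IsComplete] {W : ℝ≥0 → Ω → ℝ}
    (hW : IsBrownianReal W P) : Filtration ℝ≥0 mΩ :=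
  Filtration.rightCont
    { seq := fun t =>
        (⨆ s : ℝ≥0, ⨆ _ : s ≤ t, MeasurableSpace.comap (W s) (borel ℝ)) ⊔
          MeasurableSpace.generateFrom {N : Set Ω | P N = 0}
      mono' := fun _ _ hst =>
        sup_le_sup_right (biSup_mono fun _ h => le_trans h hst) _
      le' := fun t => by
        refine sup_le (iSup₂_le fun s _ => ?_) (MeasurableSpace.generateFrom_le fun N hN => ?_)
        · rw [← (inferInstance : BorelSpace ℝ).measurable_eq]
          exact (aemeasurable_iff_measurable.1 (hW.toIsPreBrownianReal.aemeasurable s)).comap_le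
        · exact Measure.IsComplete.out' N hN }

/-- Lebesgue measure on `[0,T]`. -/
def timeMeasure (T : ℝ≥0) : Measure ℝ≥0 :=
  (Measure.comap ((↑) : ℝ≥0 → ℝ) volume).restrict (Set.Icc 0 T)

/-- The space `L²_𝔽(0,T;ℝ^d)` of progressively measurable processes `φ` with
`E ∫₀ᵀ |φ(t)|² dt < ∞`. Only the values on `[0,T]` matter; processes are regarded as defined for
all times, e.g. by the value `0` after `T`. -/
def L2Prog (P : Measure Ω) (𝓕 : Filtration ℝ≥0 mΩ) (T : ℝ≥0) (d : ℕ) :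
    Set (ℝ≥0 → Ω → EuclideanSpace ℝ (Fin d)) :=
  {φ | IsStronglyProgressive 𝓕 φ ∧
    MemLp (fun p : ℝ≥0 × Ω => φ p.1 p.2) 2 ((timeMeasure T).prod P)}

/-- A simple process `∑ i, ξ i • 1_{(left i, right i]}`, where `ξ i` is bounded and
`𝓕_{left i}`-measurable. -/
structure SimpleProcess (𝓕 : Filtration ℝ≥0 mΩ) (d : ℕ) where
  size : ℕ
  left : Fin size → ℝ≥0
  right : Fin size → ℝ≥0
  left_le_right : ∀ i, left i ≤ right i
  ξ : Fin size → Ω → EuclideanSpace ℝ (Fin d)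
  measurable_ξ : ∀ i, StronglyMeasurable[𝓕 (left i)] (ξ i)
  bounded_ξ : ∀ i, ∃ K : ℝ, ∀ ω, ‖ξ i ω‖ ≤ K

namespace SimpleProcess

variable {𝓕 : Filtration ℝ≥0 mΩ} {d : ℕ}

/-- The value at time `t` of a simple process. -/
def value (H : SimpleProcess 𝓕 d) (t : ℝ≥0) (ω : Ω) : EuclideanSpace ℝ (Fin d) :=
  ∑ i, (Set.Ioc (H.left i) (H.right i)).indicator (fun _ => H.ξ i ω) t

/-- The stochastic integral `∫₀ᵗ H dW` of a simple process. -/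
def stochInt (W : ℝ≥0 → Ω → ℝ) (H : SimpleProcess 𝓕 d) (t : ℝ≥0) (ω : Ω) :
    EuclideanSpace ℝ (Fin d) :=
  ∑ i, (W (min t (H.right i)) ω - W (min t (H.left i)) ω) • H.ξ i ω

end SimpleProcess

/-- `M` is (a version of) the Itô integral process `M(t) = ∫₀ᵗ φ(s) dW(s)`, `t ∈ [0,T]`: the
`L²`-limit of the stochastic integrals of simple processes that converge to `φ` in
`L²([0,T] × Ω)`. -/
def IsItoIntegral (P : Measure Ω) (𝓕 : Filtration ℝ≥0 mΩ) (W : ℝ≥0 → Ω → ℝ) (T : ℝ≥0) {d : ℕ}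
    (φ M : ℝ≥0 → Ω → EuclideanSpace ℝ (Fin d)) : Prop :=
  MemLp (fun p : ℝ≥0 × Ω => φ p.1 p.2) 2 ((timeMeasure T).prod P) ∧
  (∀ t ≤ T, MemLp (M t) 2 P) ∧
  ∃ H : ℕ → SimpleProcess 𝓕 d,
    Tendsto (fun k => eLpNorm (fun p : ℝ≥0 × Ω => (H k).value p.1 p.2 - φ p.1 p.2) 2
      ((timeMeasure T).prod P)) atTop (𝓝 0) ∧
    ∀ t ≤ T, Tendsto (fun k => eLpNorm (fun ω => (H k).stochInt W t ω - M t ω) 2 P)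
      atTop (𝓝 0)

end Probability

/-! ### The game -/

/-- The product of a matrix and a Euclidean vector. -/
def mulE {a b : ℕ} (M : Matrix (Fin a) (Fin b) ℝ) (v : EuclideanSpace ℝ (Fin b)) :
    EuclideanSpace ℝ (Fin a) :=
  Matrix.toEuclideanLin M v

/-- An entrywise Lebesgue measurable, essentially bounded matrix function on `[0,T]`. -/
def IsLinfty (T : ℝ≥0) {a b : ℕ} (M : ℝ≥0 → Matrix (Fin a) (Fin b) ℝ) : Prop :=
  ∀ i j, MemLp (fun t => M t i j) ∞ (timeMeasure T)

/-- The coefficients of the state equation and the weights of the quadratic functional, for a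
state of dimension `n` and controls of dimensions `m₁`, `m₂`. -/
structure Data (n m₁ m₂ : ℕ) where
  A : ℝ≥0 → Matrix (Fin n) (Fin n) ℝ
  B₁ : ℝ≥0 → Matrix (Fin n) (Fin m₁) ℝ
  B₂ : ℝ≥0 → Matrix (Fin n) (Fin m₂) ℝ
  C : ℝ≥0 → Matrix (Fin n) (Fin n) ℝ
  D₁ : ℝ≥0 → Matrix (Fin n) (Fin m₁) ℝ
  D₂ : ℝ≥0 → Matrix (Fin n) (Fin m₂) ℝ
  G : Matrix (Fin n) (Fin n) ℝ
  Q : ℝ≥0 → Matrix (Fin n) (Fin n) ℝ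
  S₁ : ℝ≥0 → Matrix (Fin m₁) (Fin n) ℝ
  S₂ : ℝ≥0 → Matrix (Fin m₂) (Fin n) ℝ
  R₁₁ : ℝ≥0 → Matrix (Fin m₁) (Fin m₁) ℝ
  R₁₂ : ℝ≥0 → Matrix (Fin m₁) (Fin m₂) ℝ
  R₂₁ : ℝ≥0 → Matrix (Fin m₂) (Fin m₁) ℝ
  R₂₂ : ℝ≥0 → Matrix (Fin m₂) (Fin m₂) ℝ

namespace Data

variable {n m₁ m₂ : ℕ}

/-- The coefficients of the state equation are bounded measurable functions on `[0,T]`. -/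
structure CoefficientsBounded (g : Data n m₁ m₂) (T : ℝ≥0) : Prop where
  A : IsLinfty T g.A
  B₁ : IsLinfty T g.B₁
  B₂ : IsLinfty T g.B₂
  C : IsLinfty T g.C
  D₁ : IsLinfty T g.D₁
  D₂ : IsLinfty T g.D₂

/-- The weights are bounded measurable functions on `[0,T]` with the usual symmetries. -/
structure WeightsBounded (g : Data n m₁ m₂) (T : ℝ≥0) : Prop where
  G_symm : g.G.transpose = g.G
  Q : IsLinfty T g.Q
  Q_symm : ∀ t ≤ T, (g.Q t).transpose = g.Q t
  S₁ : IsLinfty T g.S₁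
  S₂ : IsLinfty T g.S₂
  R₁₁ : IsLinfty T g.R₁₁
  R₁₂ : IsLinfty T g.R₁₂
  R₂₁ : IsLinfty T g.R₂₁
  R₂₂ : IsLinfty T g.R₂₂
  R₁₁_symm : ∀ t ≤ T, (g.R₁₁ t).transpose = g.R₁₁ t
  R₁₂_symm : ∀ t ≤ T, (g.R₁₂ t).transpose = g.R₂₁ t
  R₂₂_symm : ∀ t ≤ T, (g.R₂₂ t).transpose = g.R₂₂ t

/-- The integrand of the quadratic functional at time `t`: the quadratic form of the block matrix
`(Q, S₁ᵀ, S₂ᵀ; S₁, R₁₁, R₁₂; S₂, R₂₁, R₂₂)` at the vector `(x, v₁, v₂)`. -/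
def runningCost (g : Data n m₁ m₂) (t : ℝ≥0) (x : EuclideanSpace ℝ (Fin n))
    (v₁ : EuclideanSpace ℝ (Fin m₁)) (v₂ : EuclideanSpace ℝ (Fin m₂)) : ℝ :=
  inner ℝ
      (mulE (g.Q t) x + mulE (g.S₁ t).transpose v₁ + mulE (g.S₂ t).transpose v₂) x +
    inner ℝ (mulE (g.S₁ t) x + mulE (g.R₁₁ t) v₁ + mulE (g.R₁₂ t) v₂) v₁ +
    inner ℝ (mulE (g.S₂ t) x + mulE (g.R₂₁ t) v₁ + mulE (g.R₂₂ t) v₂) v₂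

variable {Ω : Type*} {mΩ : MeasurableSpace Ω} (g : Data n m₁ m₂) (T : ℝ≥0)

/-- `X` is a strong solution on `[0,T]` of the state equation
`dX = (A X + B₁ u₁ + B₂ u₂) dt + (C X + D₁ u₁ + D₂ u₂) dW`, `X(0) = x`: a square integrable
progressively measurable process with continuous paths that satisfies the integrated equation.
By the well-posedness of linear equations such an `X` is unique up to indistinguishability. -/
structure IsState (P : Measure Ω) (𝓕 : Filtration ℝ≥0 mΩ) (W : ℝ≥0 → Ω → ℝ)
    (x : EuclideanSpace ℝ (Fin n))
    (u₁ : ℝ≥0 → Ω → EuclideanSpace ℝ (Fin m₁)) (u₂ : ℝ≥0 → Ω → EuclideanSpace ℝ (Fin m₂))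
    (X : ℝ≥0 → Ω → EuclideanSpace ℝ (Fin n)) : Prop where
  mem_L2Prog : X ∈ L2Prog P 𝓕 T n
  memLp : ∀ t ≤ T, MemLp (X t) 2 P
  continuous : ∀ᵐ ω ∂P, ContinuousOn (fun t => X t ω) (Set.Icc 0 T)
  equation : ∃ M : ℝ≥0 → Ω → EuclideanSpace ℝ (Fin n),
    IsItoIntegral P 𝓕 W T
      (fun t ω => mulE (g.C t) (X t ω) + mulE (g.D₁ t) (u₁ t ω) + mulE (g.D₂ t) (u₂ t ω)) M ∧
    ∀ t ≤ T, ∀ᵐ ω ∂P,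
      X t ω = x +
        ∫ s, (mulE (g.A s) (X s ω) + mulE (g.B₁ s) (u₁ s ω) + mulE (g.B₂ s) (u₂ s ω))
          ∂(timeMeasure t) +
        M t ω

/-- The expected payoff
`E {⟨G X(T), X(T)⟩ + ∫₀ᵀ ⟨(Q, S₁ᵀ, S₂ᵀ; S₁, R₁₁, R₁₂; S₂, R₂₁, R₂₂)(X, u₁, u₂), (X, u₁, u₂)⟩ dt}`
of the state process `X` and the controls `u₁`, `u₂`. It is `J(x;u₁,u₂)` when `X` is the state
process with initial state `x` and controls `u₁`, `u₂`. -/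
def payoff (P : Measure Ω) (X : ℝ≥0 → Ω → EuclideanSpace ℝ (Fin n))
    (u₁ : ℝ≥0 → Ω → EuclideanSpace ℝ (Fin m₁))
    (u₂ : ℝ≥0 → Ω → EuclideanSpace ℝ (Fin m₂)) : ℝ :=
  ∫ ω, (inner ℝ (mulE g.G (X T ω)) (X T ω) +
    ∫ t, g.runningCost t (X t ω) (u₁ t ω) (u₂ t ω) ∂(timeMeasure T)) ∂P

/-- The open-loop lower value `V⁻(x) = sup_{u₂} inf_{u₁} J(x;u₁,u₂)`. The payoff `J(x;u₁,u₂)` is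
evaluated along the solution `X` of the state equation; since `X` is unique up to
indistinguishability, the inner infimum over `X` is over a single number. -/
def lowerValue (P : Measure Ω) (𝓕 : Filtration ℝ≥0 mΩ) (W : ℝ≥0 → Ω → ℝ)
    (x : EuclideanSpace ℝ (Fin n)) : EReal :=
  ⨆ u₂ ∈ L2Prog P 𝓕 T m₂, ⨅ u₁ ∈ L2Prog P 𝓕 T m₁,
    ⨅ (X) (_ : g.IsState T P 𝓕 W x u₁ u₂ X), (g.payoff T P X u₁ u₂ : EReal)

/-- The open-loop upper value `V⁺(x) = inf_{u₁} sup_{u₂} J(x;u₁,u₂)`. The payoff `J(x;u₁,u₂)` is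
evaluated along the solution `X` of the state equation; since `X` is unique up to
indistinguishability, the inner supremum over `X` is over a single number. -/
def upperValue (P : Measure Ω) (𝓕 : Filtration ℝ≥0 mΩ) (W : ℝ≥0 → Ω → ℝ)
    (x : EuclideanSpace ℝ (Fin n)) : EReal :=
  ⨅ u₁ ∈ L2Prog P 𝓕 T m₁, ⨆ u₂ ∈ L2Prog P 𝓕 T m₂,
    ⨆ (X) (_ : g.IsState T P 𝓕 W x u₁ u₂ X), (g.payoff T P X u₁ u₂ : EReal)

end Data

end LQGame

end

namespace LQGame

/-! The state depends affinely on the initial value and the controls, and the payoff is quadratic in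
state and controls together. Perturbing `u₁` by `± r • v₁` with `u₂` fixed moves the state by `± r •
Y`, where `Y` starts at `0` under the controls `v₁` and `0`. The parallelogram identity then reads
J(x;u₁+rv₁,u₂) + J(x;u₁-rv₁,u₂) = 2 J(x;u₁,u₂) + 2r² J(0;v₁,0). If the lower value is finite, some
`u₂` bounds the payoff below uniformly in the first control, so J(x;u₁,u₂) + r² J(0;v₁,0) is bounded
below in `r`, which forces J(0;v₁,0) ≥ 0. The upper value is treated dually.

The work lies in superposition for the state equation (`IsState.add_smul`, resting on
`IsItoIntegral.add_smul`) and in `WeightsBounded.payoff_parallelogram`. Neither existence nor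
uniqueness of solutions is needed: finiteness of the value itself supplies one state to perturb. -/

instance (T : ℝ≥0) : IsFiniteMeasure (timeMeasure T) := by
  refine ⟨?_⟩
  have he : MeasurableEmbedding ((↑) : ℝ≥0 → ℝ) :=
    MeasurableEmbedding.subtype_coe measurableSet_Ici
  rw [timeMeasure, Measure.restrict_apply_univ, he.comap_apply]
  refine (measure_mono (t := Set.Icc (0 : ℝ) T) ?_).trans_lt (by simp)
  rintro _ ⟨s, hs, rfl⟩
  exact ⟨s.2, by exact_mod_cast hs.2⟩

theorem timeMeasure_mono {s t : ℝ≥0} (h : s ≤ t) : timeMeasure s ≤ timeMeasure t :=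
  Measure.restrict_mono (Set.Icc_subset_Icc_right h) le_rfl

/-! ### Matrix-vector products and square integrability -/

section Linear

variable {a b : ℕ}

@[simp] theorem mulE_add (M : Matrix (Fin a) (Fin b) ℝ) (v w : EuclideanSpace ℝ (Fin b)) :
    mulE M (v + w) = mulE M v + mulE M w := map_add _ v w

@[simp] theorem mulE_smul (M : Matrix (Fin a) (Fin b) ℝ) (r : ℝ) (v : EuclideanSpace ℝ (Fin b)) :
    mulE M (r • v) = r • mulE M v := map_smul _ r v

theorem mulE_apply (M : Matrix (Fin a) (Fin b) ℝ) (v : EuclideanSpace ℝ (Fin b)) (i : Fin a) :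
    mulE M v i = ∑ j, M i j * v j := rfl

theorem memLp_mulE {α : Type*} {mα : MeasurableSpace α} {μ : Measure α}
    {M : α → Matrix (Fin a) (Fin b) ℝ} (hM : ∀ i j, MemLp (fun p => M p i j) ∞ μ)
    {φ : α → EuclideanSpace ℝ (Fin b)} (hφ : MemLp φ 2 μ) :
    MemLp (fun p => mulE (M p) (φ p)) 2 μ := by
  refine MemLp.of_eval_piLp fun i => ?_
  simp only [mulE_apply]
  refine memLp_finsetSum _ fun j _ => ?_
  exact (hφ.eval_piLp j).mul (hM i j)

theorem integrable_inner_of_memLp {α : Type*} {mα : MeasurableSpace α} {μ : Measure α}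
    {φ ψ : α → EuclideanSpace ℝ (Fin a)} (hφ : MemLp φ 2 μ) (hψ : MemLp ψ 2 μ) :
    Integrable (fun p => inner ℝ (φ p) (ψ p)) μ := by
  simp only [PiLp.inner_apply]
  exact integrable_finsetSum _ fun j _ => (hψ.eval_piLp j).integrable_mul (hφ.eval_piLp j)

end Linear

variable {Ω : Type*} {mΩ : MeasurableSpace Ω} {P : Measure Ω} {𝓕 : Filtration ℝ≥0 mΩ}
  {W : ℝ≥0 → Ω → ℝ} {T : ℝ≥0} {d : ℕ}

theorem IsLinfty.memLp_comp_fst {a b : ℕ} {M : ℝ≥0 → Matrix (Fin a) (Fin b) ℝ} (hM : IsLinfty T M)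
    (P : Measure Ω) [IsFiniteMeasure P] (i : Fin a) (j : Fin b) :
    MemLp (fun p : ℝ≥0 × Ω => M p.1 i j) ∞ ((timeMeasure T).prod P) :=
  (hM i j).comp_fst P

theorem L2Prog.add_smul {φ ψ : ℝ≥0 → Ω → EuclideanSpace ℝ (Fin d)} (hφ : φ ∈ L2Prog P 𝓕 T d)
    (hψ : ψ ∈ L2Prog P 𝓕 T d) (r : ℝ) : φ + r • ψ ∈ L2Prog P 𝓕 T d :=
  ⟨fun i => (hφ.1 i).add ((hψ.1 i).const_smul r), hφ.2.add (hψ.2.const_smul r)⟩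

/-! ### Linearity of the Itô integral -/

namespace SimpleProcess

/-- The linear combination `H + r K` of two simple processes. -/
def addSMul (H : SimpleProcess 𝓕 d) (r : ℝ) (K : SimpleProcess 𝓕 d) : SimpleProcess 𝓕 d where
  size := H.size + K.size
  left := Fin.append H.left K.left
  right := Fin.append H.right K.right
  left_le_right i := by
    induction i using Fin.addCases with
    | left i => simpa using H.left_le_right i
    | right i => simpa using K.left_le_right i
  ξ := Fin.append H.ξ (fun i => r • K.ξ i)
  measurable_ξ i := by
    induction i using Fin.addCases with
    | left i =>
      rw [Fin.append_left H.left K.left i, Fin.append_left]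
      exact H.measurable_ξ i
    | right i =>
      rw [Fin.append_right H.left K.left i, Fin.append_right]
      exact (K.measurable_ξ i).const_smul r
  bounded_ξ i := by
    induction i using Fin.addCases with
    | left i => simpa using H.bounded_ξ i
    | right i =>
      obtain ⟨c, hc⟩ := K.bounded_ξ i
      refine ⟨‖r‖ * c, fun ω => ?_⟩
      simp only [Fin.append_right, Pi.smul_apply, norm_smul]
      gcongr
      exact hc ω

theorem value_addSMul (H K : SimpleProcess 𝓕 d) (r : ℝ) (t : ℝ≥0) (ω : Ω) :
    (H.addSMul r K).value t ω = H.value t ω + r • K.value t ω := by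
  refine (Fin.sum_univ_add (a := H.size) (b := K.size) _).trans ?_
  simp only [value, addSMul, Fin.append_left, Fin.append_right, Finset.smul_sum, Pi.smul_apply,
    Set.indicator_const_smul_apply]

theorem stochInt_addSMul (H K : SimpleProcess 𝓕 d) (r : ℝ) (t : ℝ≥0) (ω : Ω) :
    (H.addSMul r K).stochInt W t ω = H.stochInt W t ω + r • K.stochInt W t ω := by
  refine (Fin.sum_univ_add (a := H.size) (b := K.size) _).trans ?_
  simp only [stochInt, addSMul, Fin.append_left, Fin.append_right, Finset.smul_sum, Pi.smul_apply,
    smul_comm r]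

theorem stronglyMeasurable_value (H : SimpleProcess 𝓕 d) :
    StronglyMeasurable (fun p : ℝ≥0 × Ω => H.value p.1 p.2) := by
  refine Finset.stronglyMeasurable_fun_sum _ fun i _ => ?_
  have h : StronglyMeasurable (fun p : ℝ≥0 × Ω => H.ξ i p.2) :=
    ((H.measurable_ξ i).mono (𝓕.le _)).comp_measurable measurable_snd
  exact h.indicator (s := Prod.fst ⁻¹' Set.Ioc (H.left i) (H.right i))
    (measurable_fst measurableSet_Ioc)

theorem aestronglyMeasurable_stochInt (hW : ∀ t, AEMeasurable (W t) P) (H : SimpleProcess 𝓕 d)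
    (t : ℝ≥0) : AEStronglyMeasurable (fun ω => H.stochInt W t ω) P := by
  refine Finset.aestronglyMeasurable_fun_sum _ fun i _ => ?_
  exact ((hW _).sub (hW _)).aestronglyMeasurable.smul
    ((H.measurable_ξ i).mono (𝓕.le _)).aestronglyMeasurable

end SimpleProcess

theorem tendsto_eLpNorm_add_smul {α : Type*} {mα : MeasurableSpace α} {μ : Measure α}
    {f g : ℕ → α → EuclideanSpace ℝ (Fin d)} (hfm : ∀ k, AEStronglyMeasurable (f k) μ)
    (hgm : ∀ k, AEStronglyMeasurable (g k) μ)
    (hf : Tendsto (fun k => eLpNorm (f k) 2 μ) atTop (𝓝 0))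
    (hg : Tendsto (fun k => eLpNorm (g k) 2 μ) atTop (𝓝 0)) (r : ℝ) :
    Tendsto (fun k => eLpNorm (f k + r • g k) 2 μ) atTop (𝓝 0) := by
  have h : Tendsto (fun k => eLpNorm (f k) 2 μ + ‖r‖ₑ * eLpNorm (g k) 2 μ) atTop (𝓝 0) := by
    simpa using hf.add (ENNReal.Tendsto.const_mul hg (.inr enorm_ne_top))
  refine tendsto_of_tendsto_of_tendsto_of_le_of_le tendsto_const_nhds h (fun _ => zero_le) fun k => ?_
  refine (eLpNorm_add_le (hfm k) ((hgm k).const_smul r) one_le_two).trans_eq ?_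
  rw [eLpNorm_const_smul]

/-- Combining the two approximating sequences termwise gives one for the combination, by Minkowski's
inequality. Measurability of `W` enters only because that inequality needs measurable integrands. -/
theorem IsItoIntegral.add_smul (hW : ∀ t, AEMeasurable (W t) P)
    {φ ψ M N : ℝ≥0 → Ω → EuclideanSpace ℝ (Fin d)} (hφ : IsItoIntegral P 𝓕 W T φ M)
    (hψ : IsItoIntegral P 𝓕 W T ψ N) (r : ℝ) :
    IsItoIntegral P 𝓕 W T (φ + r • ψ) (M + r • N) := by
  obtain ⟨hφ2, hM, H, hH, hHM⟩ := hφ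
  obtain ⟨hψ2, hN, K, hK, hKN⟩ := hψ
  refine ⟨hφ2.add (hψ2.const_smul r), fun t ht => (hM t ht).add ((hN t ht).const_smul r),
    fun k => (H k).addSMul r (K k), ?_, fun t ht => ?_⟩
  · refine (tendsto_eLpNorm_add_smul
      (fun k => (H k).stronglyMeasurable_value.aestronglyMeasurable.sub hφ2.1)
      (fun k => (K k).stronglyMeasurable_value.aestronglyMeasurable.sub hψ2.1) hH hK r).congr
      fun k => congrArg (eLpNorm · 2 _) (funext fun p => ?_)
    simp only [SimpleProcess.value_addSMul, Pi.add_apply, Pi.smul_apply, Pi.sub_apply]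
    module
  · refine (tendsto_eLpNorm_add_smul
      (fun k => ((H k).aestronglyMeasurable_stochInt hW t).sub (hM t ht).1)
      (fun k => ((K k).aestronglyMeasurable_stochInt hW t).sub (hN t ht).1)
      (hHM t ht) (hKN t ht) r).congr fun k => congrArg (eLpNorm · 2 _) (funext fun p => ?_)
    simp only [SimpleProcess.stochInt_addSMul, Pi.add_apply, Pi.smul_apply, Pi.sub_apply]
    module

/-! ### Superposition of states and the parallelogram identity for the payoff -/

namespace Data

variable {n m₁ m₂ : ℕ} {g : Data n m₁ m₂} {X Y : ℝ≥0 → Ω → EuclideanSpace ℝ (Fin n)}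
  {u₁ v₁ : ℝ≥0 → Ω → EuclideanSpace ℝ (Fin m₁)} {u₂ v₂ : ℝ≥0 → Ω → EuclideanSpace ℝ (Fin m₂)}
  {x y : EuclideanSpace ℝ (Fin n)}

theorem CoefficientsBounded.ae_integrable_drift [IsFiniteMeasure P] (hg : g.CoefficientsBounded T)
    (hX : X ∈ L2Prog P 𝓕 T n) (hu₁ : u₁ ∈ L2Prog P 𝓕 T m₁) (hu₂ : u₂ ∈ L2Prog P 𝓕 T m₂) :
    ∀ᵐ ω ∂P, Integrable
      (fun s => mulE (g.A s) (X s ω) + mulE (g.B₁ s) (u₁ s ω) + mulE (g.B₂ s) (u₂ s ω))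
      (timeMeasure T) :=
  Integrable.prod_left_ae <| (((memLp_mulE (hg.A.memLp_comp_fst P) hX.2).add
    (memLp_mulE (hg.B₁.memLp_comp_fst P) hu₁.2)).add
    (memLp_mulE (hg.B₂.memLp_comp_fst P) hu₂.2)).integrable one_le_two

theorem IsState.add_smul [IsFiniteMeasure P] (hg : g.CoefficientsBounded T)
    (hW : ∀ t, AEMeasurable (W t) P) (hu₁ : u₁ ∈ L2Prog P 𝓕 T m₁) (hu₂ : u₂ ∈ L2Prog P 𝓕 T m₂)
    (hv₁ : v₁ ∈ L2Prog P 𝓕 T m₁) (hv₂ : v₂ ∈ L2Prog P 𝓕 T m₂)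
    (hX : g.IsState T P 𝓕 W x u₁ u₂ X) (hY : g.IsState T P 𝓕 W y v₁ v₂ Y) (r : ℝ) :
    g.IsState T P 𝓕 W (x + r • y) (u₁ + r • v₁) (u₂ + r • v₂) (X + r • Y) where
  mem_L2Prog := L2Prog.add_smul hX.mem_L2Prog hY.mem_L2Prog r
  memLp t ht := (hX.memLp t ht).add ((hY.memLp t ht).const_smul r)
  continuous := by
    filter_upwards [hX.continuous, hY.continuous] with ω h h'
    exact h.add (h'.const_smul r)
  equation := by
    obtain ⟨M, hM, hXM⟩ := hX.equation
    obtain ⟨N, hN, hYN⟩ := hY.equation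
    refine ⟨M + r • N, ?_, fun t ht => ?_⟩
    · convert hM.add_smul hW hN r using 1
      ext1 t
      ext1 ω
      simp only [Pi.add_apply, Pi.smul_apply, mulE_add, mulE_smul]
      module
    · filter_upwards [hXM t ht, hYN t ht, hg.ae_integrable_drift hX.mem_L2Prog hu₁ hu₂,
        hg.ae_integrable_drift hY.mem_L2Prog hv₁ hv₂] with ω h h' hi hi'
      -- The drift is integrable on `[0,T]`, whereas the equation at time `t` integrates over
      -- `[0,t]`.
      have hi := hi.mono_measure (timeMeasure_mono ht)
      have hi' := hi'.mono_measure (timeMeasure_mono ht)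
      have key : ∫ s, (mulE (g.A s) ((X + r • Y) s ω) + mulE (g.B₁ s) ((u₁ + r • v₁) s ω) +
            mulE (g.B₂ s) ((u₂ + r • v₂) s ω)) ∂(timeMeasure t) =
          ∫ s, (mulE (g.A s) (X s ω) + mulE (g.B₁ s) (u₁ s ω) + mulE (g.B₂ s) (u₂ s ω))
            ∂(timeMeasure t) +
          r • ∫ s, (mulE (g.A s) (Y s ω) + mulE (g.B₁ s) (v₁ s ω) + mulE (g.B₂ s) (v₂ s ω))
            ∂(timeMeasure t) := by
        rw [← integral_smul]
        refine (integral_congr_ae (.of_forall fun s => ?_)).trans (integral_add hi (hi'.smul r))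
        simp only [Pi.add_apply, Pi.smul_apply, mulE_add, mulE_smul]
        module
      rw [key]
      simp only [Pi.add_apply, Pi.smul_apply]
      rw [h, h']
      module

theorem WeightsBounded.integrable_runningCost [IsFiniteMeasure P] (hg : g.WeightsBounded T)
    (hX : X ∈ L2Prog P 𝓕 T n) (hu₁ : u₁ ∈ L2Prog P 𝓕 T m₁) (hu₂ : u₂ ∈ L2Prog P 𝓕 T m₂) :
    Integrable (fun p : ℝ≥0 × Ω => g.runningCost p.1 (X p.1 p.2) (u₁ p.1 p.2) (u₂ p.1 p.2))
      ((timeMeasure T).prod P) := by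
  have hS₁ : IsLinfty T fun t => (g.S₁ t).transpose := fun i j => hg.S₁ j i
  have hS₂ : IsLinfty T fun t => (g.S₂ t).transpose := fun i j => hg.S₂ j i
  refine ((integrable_inner_of_memLp (((memLp_mulE (hg.Q.memLp_comp_fst P) hX.2).add
    (memLp_mulE (hS₁.memLp_comp_fst P) hu₁.2)).add
    (memLp_mulE (hS₂.memLp_comp_fst P) hu₂.2)) hX.2).add
    (integrable_inner_of_memLp (((memLp_mulE (hg.S₁.memLp_comp_fst P) hX.2).add
    (memLp_mulE (hg.R₁₁.memLp_comp_fst P) hu₁.2)).add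
    (memLp_mulE (hg.R₁₂.memLp_comp_fst P) hu₂.2)) hu₁.2)).add
    (integrable_inner_of_memLp (((memLp_mulE (hg.S₂.memLp_comp_fst P) hX.2).add
    (memLp_mulE (hg.R₂₁.memLp_comp_fst P) hu₁.2)).add
    (memLp_mulE (hg.R₂₂.memLp_comp_fst P) hu₂.2)) hu₂.2)

theorem integrable_terminalCost [IsFiniteMeasure P] (hX : MemLp (X T) 2 P) :
    Integrable (fun ω => inner ℝ (mulE g.G (X T ω)) (X T ω)) P :=
  integrable_inner_of_memLp (memLp_mulE (fun i j => memLp_const (g.G i j)) hX) hX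

/-- Fubini: with the running cost as one integral over the product space, linearity needs only joint
integrability. -/
theorem WeightsBounded.payoff_eq_add [IsFiniteMeasure P] (hg : g.WeightsBounded T)
    (hX : X ∈ L2Prog P 𝓕 T n) (hXT : MemLp (X T) 2 P) (hu₁ : u₁ ∈ L2Prog P 𝓕 T m₁)
    (hu₂ : u₂ ∈ L2Prog P 𝓕 T m₂) :
    g.payoff T P X u₁ u₂ = ∫ ω, inner ℝ (mulE g.G (X T ω)) (X T ω) ∂P +
      ∫ p, g.runningCost p.1 (X p.1 p.2) (u₁ p.1 p.2) (u₂ p.1 p.2)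
        ∂((timeMeasure T).prod P) := by
  have h := hg.integrable_runningCost hX hu₁ hu₂
  rw [payoff, integral_add (integrable_terminalCost hXT) h.integral_prod_right, integral_prod_symm _ h]

/-- Terms of odd degree in `r` cancel, so the cross terms never have to be identified and the
symmetry of the weights plays no role. -/
theorem runningCost_parallelogram (t : ℝ≥0) (x y : EuclideanSpace ℝ (Fin n))
    (v₁ w₁ : EuclideanSpace ℝ (Fin m₁)) (v₂ w₂ : EuclideanSpace ℝ (Fin m₂)) (r : ℝ) :
    g.runningCost t (x + r • y) (v₁ + r • w₁) (v₂ + r • w₂) +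
      g.runningCost t (x + (-r) • y) (v₁ + (-r) • w₁) (v₂ + (-r) • w₂) =
    2 * g.runningCost t x v₁ v₂ + 2 * r ^ 2 * g.runningCost t y w₁ w₂ := by
  simp only [runningCost, mulE_add, mulE_smul, inner_add_left, inner_add_right, real_inner_smul_left,
    real_inner_smul_right]
  ring

theorem WeightsBounded.payoff_parallelogram [IsFiniteMeasure P] (hg : g.WeightsBounded T)
    (hX : X ∈ L2Prog P 𝓕 T n) (hXT : MemLp (X T) 2 P) (hu₁ : u₁ ∈ L2Prog P 𝓕 T m₁)
    (hu₂ : u₂ ∈ L2Prog P 𝓕 T m₂) (hY : Y ∈ L2Prog P 𝓕 T n) (hYT : MemLp (Y T) 2 P)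
    (hv₁ : v₁ ∈ L2Prog P 𝓕 T m₁) (hv₂ : v₂ ∈ L2Prog P 𝓕 T m₂) (r : ℝ) :
    g.payoff T P (X + r • Y) (u₁ + r • v₁) (u₂ + r • v₂) +
      g.payoff T P (X + (-r) • Y) (u₁ + (-r) • v₁) (u₂ + (-r) • v₂) =
    2 * g.payoff T P X u₁ u₂ + 2 * r ^ 2 * g.payoff T P Y v₁ v₂ := by
  have hZ (s : ℝ) : X + s • Y ∈ L2Prog P 𝓕 T n := L2Prog.add_smul hX hY s
  have hZT (s : ℝ) : MemLp ((X + s • Y) T) 2 P := hXT.add (hYT.const_smul s)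
  have hw₁ (s : ℝ) : u₁ + s • v₁ ∈ L2Prog P 𝓕 T m₁ := L2Prog.add_smul hu₁ hv₁ s
  have hw₂ (s : ℝ) : u₂ + s • v₂ ∈ L2Prog P 𝓕 T m₂ := L2Prog.add_smul hu₂ hv₂ s
  have hG := integral_add (integrable_terminalCost (g := g) (hZT r))
    (integrable_terminalCost (g := g) (hZT (-r)))
  have hG' := integral_add ((integrable_terminalCost (g := g) hXT).const_mul 2)
    ((integrable_terminalCost (g := g) hYT).const_mul (2 * r ^ 2))
  have hR := integral_add (hg.integrable_runningCost (hZ r) (hw₁ r) (hw₂ r))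
    (hg.integrable_runningCost (hZ (-r)) (hw₁ (-r)) (hw₂ (-r)))
  have hR' := integral_add ((hg.integrable_runningCost hX hu₁ hu₂).const_mul 2)
    ((hg.integrable_runningCost hY hv₁ hv₂).const_mul (2 * r ^ 2))
  have eG : ∀ ω, inner ℝ (mulE g.G ((X + r • Y) T ω)) ((X + r • Y) T ω) +
      inner ℝ (mulE g.G ((X + (-r) • Y) T ω)) ((X + (-r) • Y) T ω) =
      2 * inner ℝ (mulE g.G (X T ω)) (X T ω) + 2 * r ^ 2 * inner ℝ (mulE g.G (Y T ω)) (Y T ω) := by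
    intro ω
    simp only [Pi.add_apply, Pi.smul_apply, mulE_add, mulE_smul, inner_add_left, inner_add_right,
      real_inner_smul_left, real_inner_smul_right]
    ring
  simp only [eG] at hG
  simp only [Pi.add_apply, Pi.smul_apply, runningCost_parallelogram] at hR
  rw [hG, integral_const_mul, integral_const_mul] at hG'
  rw [hR, integral_const_mul, integral_const_mul] at hR'
  rw [hg.payoff_eq_add (hZ r) (hZT r) (hw₁ r) (hw₂ r),
    hg.payoff_eq_add (hZ (-r)) (hZT (-r)) (hw₁ (-r)) (hw₂ (-r)),
    hg.payoff_eq_add hX hXT hu₁ hu₂, hg.payoff_eq_add hY hYT hv₁ hv₂]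
  simp only [Pi.add_apply, Pi.smul_apply] at hG' hR' ⊢
  linarith

end Data

theorem zero_mem_L2Prog : (0 : ℝ≥0 → Ω → EuclideanSpace ℝ (Fin d)) ∈ L2Prog P 𝓕 T d :=
  ⟨isStronglyProgressive_const 𝓕 0, MemLp.zero⟩

theorem nonneg_of_forall_le_add_sq_mul {a b c : ℝ} (h : ∀ r : ℝ, c ≤ a + r ^ 2 * b) : 0 ≤ b := by
  by_contra! hb
  -- This `r` makes `r ^ 2 * b = -(|c - a| + 1)`, hence `c - a ≤ -|c - a| - 1`, which is absurd.
  have h1 := h √((|c - a| + 1) / -b)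
  rw [Real.sq_sqrt (by have := neg_pos.2 hb; positivity), div_neg, neg_mul,
    div_mul_cancel₀ _ hb.ne] at h1
  linarith [neg_abs_le (c - a)]

/-! ### Sign of the homogeneous payoff from finiteness of the values -/

namespace Data

variable {n m₁ m₂ : ℕ} {g : Data n m₁ m₂} {x : EuclideanSpace ℝ (Fin n)} {v : ℝ}

theorem payoff_nonneg_of_lowerValue_eq_coe [IsFiniteMeasure P] (hA : g.CoefficientsBounded T)
    (hg : g.WeightsBounded T) (hW : ∀ t, AEMeasurable (W t) P)
    (hv : g.lowerValue T P 𝓕 W x = (v : EReal))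
    {v₁ : ℝ≥0 → Ω → EuclideanSpace ℝ (Fin m₁)} (hv₁ : v₁ ∈ L2Prog P 𝓕 T m₁)
    {Y : ℝ≥0 → Ω → EuclideanSpace ℝ (Fin n)} (hY : g.IsState T P 𝓕 W 0 v₁ 0 Y) :
    0 ≤ g.payoff T P Y v₁ 0 := by
  -- Anything strictly below the supremum is exceeded by the inner infimum for some `u₂`; the slack
  -- `1` is arbitrary.
  have hlt : ((v - 1 : ℝ) : EReal) < g.lowerValue T P 𝓕 W x := by
    rw [hv]; exact_mod_cast sub_one_lt v
  simp only [lowerValue, lt_iSup_iff] at hlt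
  obtain ⟨u₂, hu₂, hlt⟩ := hlt
  have hlow : ∀ u₁ ∈ L2Prog P 𝓕 T m₁, ∀ X, g.IsState T P 𝓕 W x u₁ u₂ X →
      v - 1 ≤ g.payoff T P X u₁ u₂ := fun u₁ hu₁ X hX =>
    EReal.coe_le_coe_iff.1 (hlt.le.trans
      ((iInf₂_le u₁ hu₁).trans (iInf₂_le X hX)))
  -- An infimum over no states would be `⊤`. Being at most `v`, it ranges over at least one control
  -- `u₁` with a state `X`, the base point of the perturbation.
  have htop : ⨅ u₁ ∈ L2Prog P 𝓕 T m₁, ⨅ (X) (_ : g.IsState T P 𝓕 W x u₁ u₂ X),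
      (g.payoff T P X u₁ u₂ : EReal) < ⊤ := by
    refine lt_of_le_of_lt ?_ (hv.trans_lt (EReal.coe_lt_top v))
    exact le_iSup₂_of_le u₂ hu₂ le_rfl
  simp only [iInf_lt_iff] at htop
  obtain ⟨u₁, hu₁, X, hX, -⟩ := htop
  refine nonneg_of_forall_le_add_sq_mul (a := g.payoff T P X u₁ u₂) (c := v - 1) fun r => ?_
  have key (s : ℝ) : v - 1 ≤ g.payoff T P (X + s • Y) (u₁ + s • v₁) (u₂ + s • 0) := by
    have hs := hX.add_smul hA hW hu₁ hu₂ hv₁ zero_mem_L2Prog hY s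
    simp only [smul_zero, add_zero] at hs ⊢
    exact hlow _ (L2Prog.add_smul hu₁ hv₁ s) _ hs
  linarith [key r, key (-r), hg.payoff_parallelogram hX.mem_L2Prog (hX.memLp T le_rfl) hu₁ hu₂
    hY.mem_L2Prog (hY.memLp T le_rfl) hv₁ zero_mem_L2Prog r]

theorem payoff_nonpos_of_upperValue_eq_coe [IsFiniteMeasure P] (hA : g.CoefficientsBounded T)
    (hg : g.WeightsBounded T) (hW : ∀ t, AEMeasurable (W t) P)
    (hv : g.upperValue T P 𝓕 W x = (v : EReal))
    {v₂ : ℝ≥0 → Ω → EuclideanSpace ℝ (Fin m₂)} (hv₂ : v₂ ∈ L2Prog P 𝓕 T m₂)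
    {Y : ℝ≥0 → Ω → EuclideanSpace ℝ (Fin n)} (hY : g.IsState T P 𝓕 W 0 0 v₂ Y) :
    g.payoff T P Y 0 v₂ ≤ 0 := by
  have hlt : g.upperValue T P 𝓕 W x < ((v + 1 : ℝ) : EReal) := by
    rw [hv]; exact_mod_cast lt_add_one v
  simp only [upperValue, iInf_lt_iff] at hlt
  obtain ⟨u₁, hu₁, hlt⟩ := hlt
  have hupp : ∀ u₂ ∈ L2Prog P 𝓕 T m₂, ∀ X, g.IsState T P 𝓕 W x u₁ u₂ X →
      g.payoff T P X u₁ u₂ ≤ v + 1 := fun u₂ hu₂ X hX =>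
    EReal.coe_le_coe_iff.1 <| by
      refine le_trans ?_ hlt.le
      refine le_trans ?_ (le_iSup₂ u₂ hu₂)
      exact le_iSup₂ (f := fun X (_ : g.IsState T P 𝓕 W x u₁ u₂ X) =>
        (g.payoff T P X u₁ u₂ : EReal)) X hX
  -- Dually, a supremum over no states would be `⊥`, so a control `u₂` with a state exists.
  have hbot : ⊥ < ⨆ u₂ ∈ L2Prog P 𝓕 T m₂, ⨆ (X) (_ : g.IsState T P 𝓕 W x u₁ u₂ X),
      (g.payoff T P X u₁ u₂ : EReal) := by
    refine ((EReal.bot_lt_coe v).trans_eq hv.symm).trans_le ?_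
    exact iInf₂_le u₁ hu₁
  simp only [lt_iSup_iff] at hbot
  obtain ⟨u₂, hu₂, X, hX, -⟩ := hbot
  rw [← neg_nonneg]
  refine nonneg_of_forall_le_add_sq_mul (a := -g.payoff T P X u₁ u₂) (c := -(v + 1)) fun r => ?_
  have key (s : ℝ) : g.payoff T P (X + s • Y) (u₁ + s • 0) (u₂ + s • v₂) ≤ v + 1 := by
    have hs := hX.add_smul hA hW hu₁ hu₂ zero_mem_L2Prog hv₂ hY s
    simp only [smul_zero, add_zero] at hs ⊢
    exact hupp _ (L2Prog.add_smul hu₂ hv₂ s) _ hs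
  linarith [key r, key (-r), hg.payoff_parallelogram hX.mem_L2Prog (hX.memLp T le_rfl) hu₁ hu₂
    hY.mem_L2Prog (hY.memLp T le_rfl) zero_mem_L2Prog hv₂ r]

end Data

end LQGame

theorem mainTheorem5 {Ω : Type*} {mΩ : MeasurableSpace Ω} (P : Measure Ω) [IsProbabilityMeasure P]
    [P.IsComplete] (W : ℝ≥0 → Ω → ℝ) (hW : IsBrownianReal W P) (T : ℝ≥0) (hT : 0 < T)
    {n m₁ m₂ : ℕ} (g : LQGame.Data n m₁ m₂) (hA1 : g.CoefficientsBounded T)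
    (hA2 : g.WeightsBounded T) :
    ((∃ x : EuclideanSpace ℝ (Fin n), ∃ v : ℝ,
        g.lowerValue T P (LQGame.brownianFiltration hW) W x = (v : EReal)) →
      ∀ u₁ ∈ LQGame.L2Prog P (LQGame.brownianFiltration hW) T m₁,
        ∀ X : ℝ≥0 → Ω → EuclideanSpace ℝ (Fin n),
          g.IsState T P (LQGame.brownianFiltration hW) W 0 u₁ 0 X →
            0 ≤ g.payoff T P X u₁ 0) ∧
    ((∃ x : EuclideanSpace ℝ (Fin n), ∃ v : ℝ,
        g.upperValue T P (LQGame.brownianFiltration hW) W x = (v : EReal)) →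
      ∀ u₂ ∈ LQGame.L2Prog P (LQGame.brownianFiltration hW) T m₂,
        ∀ X : ℝ≥0 → Ω → EuclideanSpace ℝ (Fin n),
          g.IsState T P (LQGame.brownianFiltration hW) W 0 0 u₂ X →
            g.payoff T P X 0 u₂ ≤ 0) := by
  have hWm := hW.toIsPreBrownianReal.aemeasurable
  exact ⟨fun ⟨_, _, hv⟩ _ hu₁ _ hX =>
      LQGame.Data.payoff_nonneg_of_lowerValue_eq_coe hA1 hA2 hWm hv hu₁ hX,
    fun ⟨_, _, hv⟩ _ hu₂ _ hX =>
      LQGame.Data.payoff_nonpos_of_upperValue_eq_coe hA1 hA2 hWm hv hu₂ hX⟩
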